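/- Let $S$ be a commutative inverse semigroup (for every $s\in S$ there is a unique $s^*\in S$ with $ss^*s=s$ and $s^*ss^*=s^*$) and let $E=\{e\in S: e^2=e\}$. Suppose that $E$ satisfies the Duncan–Namioka condition $D_k$ for some integer $k\ge 1$: for all $f_1,\dots,f_{k+1}\in E$ there are $e\in E$ and indices $1\le i<j\le k+1$ with $f_ie=f_i$ and $f_je=f_j$. Let $\ell^1(S)$ be the complex convolution Banach algebra of $S$, let $\ell^1(E)\subseteq \ell^1(S)$ be the closed subalgebra of the functions that vanish off $E$, and put $$\mathcal T_0=\Big\{\begin{bmatrix}a&m\\0&b\end{bmatrix}: a,m,b\in\ell^1(S)\Big\},\qquad \mathfrak T_0=\Big\{\begin{bmatrix}\alpha&0\\0&\alpha\end{bmatrix}:\alpha\in\ell^1(E)\Big\},$$ with matrix operations and the norm $\|a\|+\|m\|+\|b\|$ on $\mathcal T_0$. Regard $\mathcal T_0$ as a Banach $\mathfrak T_0$-bimodule under matrix multiplication. Then $\mathcal T_0$ is permanently weakly module amenable as a $\mathfrak T_0$-module, that is, $n$-weakly module amenable for every integer $n\ge 1$. Here, if a Banach algebra $\mathcal A$ is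 a Banach bimodule over a Banach algebra $\mathfrak A$ with $\alpha\cdot(ab)=(\alpha\cdot a)b$ and $(ab)\cdot\alpha=a(b\cdot\alpha)$, let $J$ be the closed two-sided ideal of $\mathcal A$ generated by the elements $(a\cdot\alpha)b-a(\alpha\cdot b)$ with $a,b\in\mathcal A$ and $\alpha\in\mathfrak A$, and let $(\mathcal A/J)^{(n)}$ be the $n$-th dual of $\mathcal A/J$ with the induced actions, where the actions on a dual are $\langle a\cdot f,x\rangle=\langle f,x\cdot a\rangle$ and $\langle f\cdot a,x\rangle=\langle f,a\cdot x\rangle$, and likewise for $\mathfrak A$. A module derivation $D:\mathcal A\to X$ is a map, not necessarily $\mathbb C$-linear, such that $D(a\pm b)=D(a)\pm D(b)$, $D(\alpha\cdot a)=\alpha\cdot D(a)$, $D(a\cdot\alpha)=D(a)\cdot\alpha$ and $D(ab)=D(a)\cdot b+a\cdot D(b)$, and such that $\|D(a)\|\le M\|a\|$ for all $a\in\mathcal A$, for some constant $M>0$. The algebra $\mathcal A$ is $n$-weakly module amenable as an $\mathfrak A$-module if $\alpha\cdot x=x\cdot\alpha$ for all $\alpha\in\mathfrak A$ and $x\in(\mathcal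 A/J)^{(n)}$, and every module derivation $D:\mathcal A\to(\mathcal A/J)^{(n)}$ is inner: there is $y\in(\mathcal A/J)^{(n)}$ with $D(a)=a\cdot y-y\cdot a$ for all $a\in\mathcal A$. -/

import Mathlib

open scoped ENNReal

universe u v

noncomputable section

/-! ### Banach modules -/

/-- A Banach `R`-bimodule structure with compatible actions on a Banach algebra `A`, for a Banach
algebra `R` (completeness of `A` is assumed below, where it is used).
`left α a` is `α · a` and `right α a` is `a · α`; both are bounded bilinear. -/
structure BanachAlgebraBimodule (A : Type u) (R : Type v)
    [NonUnitalNormedRing A] [NormedSpace ℂ A] [NonUnitalNormedRing R] [NormedSpace ℂ R] where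
  left : R →L[ℂ] A →L[ℂ] A
  right : R →L[ℂ] A →L[ℂ] A
  left_mul : ∀ α β a, left (α * β) a = left α (left β a)
  right_mul : ∀ α β a, right (α * β) a = right β (right α a)
  left_right : ∀ α β a, left α (right β a) = right β (left α a)
  left_compat : ∀ α a b, left α (a * b) = left α a * b
  right_compat : ∀ α a b, right α (a * b) = a * right α b

/-- A Banach `A`-`R`-module: a Banach space which is a Banach `A`-bimodule and a Banach
`R`-bimodule with compatible actions. `left a x` is `a · x`, `right a x` is `x · a`,
`leftR α x` is `α · x` and `rightR α x` is `x · α`. -/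
structure BanachModule {A : Type u} {R : Type v}
    [NonUnitalNormedRing A] [NormedSpace ℂ A] [NonUnitalNormedRing R] [NormedSpace ℂ R]
    (P : BanachAlgebraBimodule A R) where
  carrier : Type u
  [normedAddCommGroup : NormedAddCommGroup carrier]
  [normedSpace : NormedSpace ℂ carrier]
  [completeSpace : CompleteSpace carrier]
  left : A →L[ℂ] carrier →L[ℂ] carrier
  right : A →L[ℂ] carrier →L[ℂ] carrier
  leftR : R →L[ℂ] carrier →L[ℂ] carrier
  rightR : R →L[ℂ] carrier →L[ℂ] carrier
  left_mul : ∀ a b x, left (a * b) x = left a (left b x)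
  right_mul : ∀ a b x, right (a * b) x = right b (right a x)
  left_right : ∀ a b x, left a (right b x) = right b (left a x)
  leftR_mul : ∀ α β x, leftR (α * β) x = leftR α (leftR β x)
  rightR_mul : ∀ α β x, rightR (α * β) x = rightR β (rightR α x)
  leftR_rightR : ∀ α β x, leftR α (rightR β x) = rightR β (leftR α x)
  /-- `α · (a · x) = (α · a) · x` -/
  leftR_left : ∀ α a x, leftR α (left a x) = left (P.left α a) x
  /-- `(α · x) · a = α · (x · a)` -/
  right_leftR : ∀ α a x, right a (leftR α x) = leftR α (right a x)
  /-- `x · (a · α) = (x · a) · α` -/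
  right_rightR : ∀ α a x, right (P.right α a) x = rightR α (right a x)
  /-- `(a · x) · α = a · (x · α)` -/
  rightR_left : ∀ α a x, rightR α (left a x) = left a (rightR α x)
  /-- `a · (α · x) = (a · α) · x` -/
  left_leftR : ∀ α a x, left a (leftR α x) = left (P.right α a) x
  /-- `x · (α · a) = (x · α) · a` -/
  right_left_compat : ∀ α a x, right (P.left α a) x = right a (rightR α x)

attribute [instance] BanachModule.normedAddCommGroup BanachModule.normedSpace
  BanachModule.completeSpace

namespace BanachModule

variable {A : Type u} {R : Type v}
  [NonUnitalNormedRing A] [NormedSpace ℂ A] [NonUnitalNormedRing R] [NormedSpace ℂ R]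
  {P : BanachAlgebraBimodule A R}

/-- The transpose of a bounded bilinear action: `(transpose T a f) x = f (T a x)`. -/
def transpose {B X : Type*} [NormedAddCommGroup B] [NormedSpace ℂ B]
    [NormedAddCommGroup X] [NormedSpace ℂ X] (T : B →L[ℂ] X →L[ℂ] X) :
    B →L[ℂ] StrongDual ℂ X →L[ℂ] StrongDual ℂ X :=
  (ContinuousLinearMap.compL ℂ X X ℂ).flip.comp T

@[simp] theorem transpose_apply {B X : Type*} [NormedAddCommGroup B] [NormedSpace ℂ B]
    [NormedAddCommGroup X] [NormedSpace ℂ X] (T : B →L[ℂ] X →L[ℂ] X) (b : B)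
    (f : StrongDual ℂ X) (x : X) : transpose T b f x = f (T b x) := rfl

/-- The dual module `X*`, with `⟨a · f, x⟩ = ⟨f, x · a⟩`, `⟨f · a, x⟩ = ⟨f, a · x⟩` and the
same formulas for the actions of `R`. -/
def dual (X : BanachModule P) : BanachModule P where
  carrier := StrongDual ℂ X.carrier
  left := transpose X.right
  right := transpose X.left
  leftR := transpose X.rightR
  rightR := transpose X.leftR
  left_mul a b f := by ext x; simp [X.right_mul]
  right_mul a b f := by ext x; simp [X.left_mul]
  left_right a b f := by ext x; simp [X.left_right]
  leftR_mul a b f := by ext x; simp [X.rightR_mul]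
  rightR_mul a b f := by ext x; simp [X.leftR_mul]
  leftR_rightR a b f := by ext x; simp [X.leftR_rightR]
  leftR_left α a f := by ext x; simp [X.right_left_compat]
  right_leftR α a f := by ext x; simp [X.rightR_left]
  right_rightR α a f := by ext x; simp [X.left_leftR]
  rightR_left α a f := by ext x; simp [X.right_leftR]
  left_leftR α a f := by ext x; simp [X.right_rightR]
  right_left_compat α a f := by ext x; simp [X.leftR_left]

/-- The `n`-th dual `X⁽ⁿ⁾`, with `X⁽⁰⁾ = X`. -/
def iteratedDual (X : BanachModule P) : ℕ → BanachModule P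
  | 0 => X
  | n + 1 => (X.iteratedDual n).dual

/-- A commutative Banach `A`-`R`-module: `α · x = x · α`. -/
def IsCommutative (X : BanachModule P) : Prop :=
  ∀ (α : R) (x : X.carrier), X.leftR α x = X.rightR α x

/-- An `R`-module derivation `D : A → X`: a bounded `R`-bimodule map, additive but not assumed
to be `ℂ`-linear, with `D (ab) = D a · b + a · D b`. -/
structure IsModuleDerivation (X : BanachModule P) (D : A → X.carrier) : Prop where
  map_add : ∀ a b, D (a + b) = D a + D b
  map_sub : ∀ a b, D (a - b) = D a - D b
  map_left : ∀ (α : R) (a : A), D (P.left α a) = X.leftR α (D a)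
  map_right : ∀ (α : R) (a : A), D (P.right α a) = X.rightR α (D a)
  bounded : ∃ M : ℝ, 0 < M ∧ ∀ a, ‖D a‖ ≤ M * ‖a‖
  leibniz : ∀ a b, D (a * b) = X.right b (D a) + X.left a (D b)

/-- `D` is inner: `D a = a · y - y · a` for some `y` in `X`. -/
def IsInner (X : BanachModule P) (D : A → X.carrier) : Prop :=
  ∃ y : X.carrier, ∀ a, D a = X.left a y - X.right a y

end BanachModule

/-! ### The quotient module and weak module amenability -/

namespace BanachAlgebraBimodule

variable {A : Type u} {R : Type v}
  [NonUnitalNormedRing A] [NormedSpace ℂ A] [NonUnitalNormedRing R] [NormedSpace ℂ R]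
  (P : BanachAlgebraBimodule A R)

/-- `I` is a closed two-sided ideal of `A` that contains all `(a · α) b - a (α · b)`. -/
structure IsCompatIdeal (I : Submodule ℂ A) : Prop where
  isClosed : IsClosed (I : Set A)
  mul_mem_left : ∀ a x, x ∈ I → a * x ∈ I
  mul_mem_right : ∀ a x, x ∈ I → x * a ∈ I
  gen_mem : ∀ (α : R) (a b : A), P.right α a * b - a * P.left α b ∈ I

/-- `J`, the closed ideal of `A` generated by the elements `(a · α) b - a (α · b)`. -/
def J : Submodule ℂ A := sInf {I | P.IsCompatIdeal I}

theorem mem_J {x : A} : x ∈ P.J ↔ ∀ I, P.IsCompatIdeal I → x ∈ I := by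
  simp [J, Submodule.mem_sInf]

theorem isCompatIdeal_J : P.IsCompatIdeal P.J where
  isClosed := by
    have : (P.J : Set A) = ⋂ I ∈ {I | P.IsCompatIdeal I}, (I : Set A) := by
      simp [J, Submodule.coe_sInf]
    rw [this]
    exact isClosed_biInter fun I hI => hI.isClosed
  mul_mem_left a x hx := P.mem_J.2 fun I hI => hI.mul_mem_left a x (P.mem_J.1 hx I hI)
  mul_mem_right a x hx := P.mem_J.2 fun I hI => hI.mul_mem_right a x (P.mem_J.1 hx I hI)
  gen_mem α a b := P.mem_J.2 fun I hI => hI.gen_mem α a b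

instance isClosed_J : IsClosed (P.J : Set A) := P.isCompatIdeal_J.isClosed

theorem left_mem_J (α : R) {x : A} (hx : x ∈ P.J) : P.left α x ∈ P.J := by
  have h : P.IsCompatIdeal (P.J ⊓ P.J.comap (P.left α : A →ₗ[ℂ] A)) :=
    { isClosed := P.isClosed_J.inter (P.isClosed_J.preimage (P.left α).continuous)
      mul_mem_left := by
        rintro a x ⟨h1, h2⟩
        refine ⟨P.isCompatIdeal_J.mul_mem_left a x h1, ?_⟩
        change P.left α (a * x) ∈ P.J
        rw [P.left_compat]
        exact P.isCompatIdeal_J.mul_mem_left _ x h1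
      mul_mem_right := by
        rintro a x ⟨h1, h2⟩
        refine ⟨P.isCompatIdeal_J.mul_mem_right a x h1, ?_⟩
        change P.left α (x * a) ∈ P.J
        rw [P.left_compat]
        exact P.isCompatIdeal_J.mul_mem_right a _ h2
      gen_mem := by
        intro β a b
        refine ⟨P.isCompatIdeal_J.gen_mem β a b, ?_⟩
        change P.left α (P.right β a * b - a * P.left β b) ∈ P.J
        rw [map_sub, P.left_compat, P.left_compat, P.left_right]
        exact P.isCompatIdeal_J.gen_mem β _ b }
  exact (P.mem_J.1 hx _ h).2

theorem right_mem_J (α : R) {x : A} (hx : x ∈ P.J) : P.right α x ∈ P.J := by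
  have h : P.IsCompatIdeal (P.J ⊓ P.J.comap (P.right α : A →ₗ[ℂ] A)) :=
    { isClosed := P.isClosed_J.inter (P.isClosed_J.preimage (P.right α).continuous)
      mul_mem_left := by
        rintro a x ⟨h1, h2⟩
        refine ⟨P.isCompatIdeal_J.mul_mem_left a x h1, ?_⟩
        change P.right α (a * x) ∈ P.J
        rw [P.right_compat]
        exact P.isCompatIdeal_J.mul_mem_left a _ h2
      mul_mem_right := by
        rintro a x ⟨h1, h2⟩
        refine ⟨P.isCompatIdeal_J.mul_mem_right a x h1, ?_⟩
        change P.right α (x * a) ∈ P.J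
        rw [P.right_compat]
        exact P.isCompatIdeal_J.mul_mem_right _ x h1
      gen_mem := by
        intro β a b
        refine ⟨P.isCompatIdeal_J.gen_mem β a b, ?_⟩
        change P.right α (P.right β a * b - a * P.left β b) ∈ P.J
        rw [map_sub, P.right_compat, P.right_compat, ← P.left_right]
        exact P.isCompatIdeal_J.gen_mem β a _ }
  exact (P.mem_J.1 hx _ h).2

/-- The action on `A ⧸ J` induced by an action on `A` that leaves `J` invariant:
`quotientAction T h b (x + J) = T b x + J`. -/
def quotientAction {B : Type*} [NormedAddCommGroup B] [NormedSpace ℂ B]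
    (T : B →L[ℂ] A →L[ℂ] A) (h : ∀ b x, x ∈ P.J → T b x ∈ P.J) :
    B →L[ℂ] (A ⧸ P.J) →L[ℂ] (A ⧸ P.J) :=
  LinearMap.mkContinuous₂
    (LinearMap.mk₂ ℂ (fun b x => P.J.mapQ P.J (T b : A →ₗ[ℂ] A) (fun x hx => h b x hx) x)
      (by intro b c x; induction x using Submodule.Quotient.induction_on; simp)
      (by intro c b x; induction x using Submodule.Quotient.induction_on; simp)
      (by intro b x y; simp)
      (by intro c b x; simp))
    ‖T‖ (by
      intro b x
      refine le_of_forall_pos_le_add fun ε hε => ?_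
      have hC : 0 < ‖T‖ * ‖b‖ + 1 := by positivity
      obtain ⟨m, rfl, hm⟩ := Submodule.Quotient.norm_mk_lt x (div_pos hε hC)
      have h1 : ‖T b m‖ ≤ ‖T‖ * ‖b‖ * ‖m‖ := T.le_opNorm₂ b m
      have h2 : (‖T‖ * ‖b‖) * (ε / (‖T‖ * ‖b‖ + 1)) ≤ ε := by
        rw [mul_div_assoc', div_le_iff₀ hC]
        nlinarith
      calc _ ≤ ‖T b m‖ := Submodule.Quotient.norm_mk_le _ _
        _ ≤ ‖T‖ * ‖b‖ * ‖m‖ := h1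
        _ ≤ ‖T‖ * ‖b‖ * (‖(Submodule.Quotient.mk m : A ⧸ P.J)‖ + ε / (‖T‖ * ‖b‖ + 1)) := by
          gcongr
        _ ≤ _ := by rw [mul_add]; gcongr)

@[simp] theorem quotientAction_mk {B : Type*} [NormedAddCommGroup B] [NormedSpace ℂ B]
    (T : B →L[ℂ] A →L[ℂ] A) (h : ∀ b x, x ∈ P.J → T b x ∈ P.J) (b : B) (x : A) :
    P.quotientAction T h b (Submodule.Quotient.mk x) = Submodule.Quotient.mk (T b x) := rfl

variable [IsScalarTower ℂ A A] [SMulCommClass ℂ A A] [CompleteSpace A]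

/-- The quotient `A ⧸ J` as a Banach `A`-`R`-module. -/
def quotientModule : BanachModule P where
  carrier := A ⧸ P.J
  left := P.quotientAction (ContinuousLinearMap.mul ℂ A)
    (fun a x hx => by simpa using P.isCompatIdeal_J.mul_mem_left a x hx)
  right := P.quotientAction (ContinuousLinearMap.mul ℂ A).flip
    (fun a x hx => by simpa using P.isCompatIdeal_J.mul_mem_right a x hx)
  leftR := P.quotientAction P.left (fun α _ hx => P.left_mem_J α hx)
  rightR := P.quotientAction P.right (fun α _ hx => P.right_mem_J α hx)
  left_mul a b x := by
    induction x using Submodule.Quotient.induction_on; simp [mul_assoc]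
  right_mul a b x := by
    induction x using Submodule.Quotient.induction_on; simp [mul_assoc]
  left_right a b x := by
    induction x using Submodule.Quotient.induction_on; simp [mul_assoc]
  leftR_mul α β x := by
    induction x using Submodule.Quotient.induction_on; simp [P.left_mul]
  rightR_mul α β x := by
    induction x using Submodule.Quotient.induction_on; simp [P.right_mul]
  leftR_rightR α β x := by
    induction x using Submodule.Quotient.induction_on; simp [P.left_right]
  leftR_left α a x := by
    induction x using Submodule.Quotient.induction_on; simp [P.left_compat]
  right_leftR α a x := by
    induction x using Submodule.Quotient.induction_on; simp [P.left_compat]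
  right_rightR α a x := by
    induction x using Submodule.Quotient.induction_on; simp [P.right_compat]
  rightR_left α a x := by
    induction x using Submodule.Quotient.induction_on; simp [P.right_compat]
  left_leftR α a x := by
    induction x using Submodule.Quotient.induction_on with
    | _ x =>
      simp only [quotientAction_mk, ContinuousLinearMap.mul_apply']
      rw [eq_comm, Submodule.Quotient.eq]
      exact P.isCompatIdeal_J.gen_mem α a x
  right_left_compat α a x := by
    induction x using Submodule.Quotient.induction_on with
    | _ x =>
      simp only [quotientAction_mk, ContinuousLinearMap.flip_apply,
        ContinuousLinearMap.mul_apply']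
      rw [eq_comm, Submodule.Quotient.eq]
      exact P.isCompatIdeal_J.gen_mem α x a

/-- `A` is `n`-weakly module amenable as an `R`-module: `(A ⧸ J)⁽ⁿ⁾` is a commutative
`A`-`R`-module and every module derivation `A → (A ⧸ J)⁽ⁿ⁾` is inner. -/
def IsWeaklyModuleAmenable (n : ℕ) : Prop :=
  (P.quotientModule.iteratedDual n).IsCommutative ∧
    ∀ D : A → (P.quotientModule.iteratedDual n).carrier,
      (P.quotientModule.iteratedDual n).IsModuleDerivation D →
        (P.quotientModule.iteratedDual n).IsInner D

/-- `A` is permanently weakly module amenable as an `R`-module. -/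
def IsPermanentlyWeaklyModuleAmenable : Prop :=
  ∀ n : ℕ, 1 ≤ n → P.IsWeaklyModuleAmenable n

end BanachAlgebraBimodule

section Multiplication

variable {A : Type u} [NonUnitalNormedRing A] [NormedSpace ℂ A] [IsScalarTower ℂ A A]
  [SMulCommClass ℂ A A]

instance NonUnitalSubalgebra.normedSpaceComplex (B : NonUnitalSubalgebra ℂ A) :
    NormedSpace ℂ B where
  norm_smul_le c b := norm_smul_le c (b : A)

/-- A Banach algebra `A` as a bimodule over a subalgebra `B`, acting by multiplication in `A`. -/
def BanachAlgebraBimodule.ofSubalgebra (B : NonUnitalSubalgebra ℂ A) :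
    BanachAlgebraBimodule A B where
  left := (ContinuousLinearMap.mul ℂ A).comp B.toSubmodule.subtypeL
  right := (ContinuousLinearMap.mul ℂ A).flip.comp B.toSubmodule.subtypeL
  left_mul α β a := mul_assoc (α : A) β a
  right_mul α β a := (mul_assoc a (α : A) β).symm
  left_right α β a := (mul_assoc (α : A) a β).symm
  left_compat α a b := (mul_assoc (α : A) a b).symm
  right_compat α a b := mul_assoc a b (α : A)

@[simp] theorem BanachAlgebraBimodule.ofSubalgebra_left (B : NonUnitalSubalgebra ℂ A) (b : B)
    (a : A) : (ofSubalgebra B).left b a = (b : A) * a := rfl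

@[simp] theorem BanachAlgebraBimodule.ofSubalgebra_right (B : NonUnitalSubalgebra ℂ A) (b : B)
    (a : A) : (ofSubalgebra B).right b a = a * (b : A) := rfl

end Multiplication

/-! ### The semigroup algebra `ℓ¹(S)` -/

/-- The Banach space `ℓ¹(S)`; it carries the convolution product defined below. -/
abbrev L1 (S : Type u) : Type u := lp (fun _ : S => ℂ) 1

namespace L1

open scoped Classical in
/-- The point mass `δ_s`. -/
def delta {S : Type u} (s : S) : L1 S := lp.single 1 s (1 : ℂ)

variable {S : Type u}

theorem delta_apply_ne {s t : S} (h : t ≠ s) : delta s t = 0 := by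
  classical
  rw [delta, lp.single_apply_ne _ _ _ h]

@[simp] theorem delta_apply_self (s : S) : delta s s = 1 := by
  classical
  rw [delta, lp.single_apply_self]

@[simp] theorem norm_delta (s : S) : ‖delta s‖ = 1 := by
  classical
  rw [delta, lp.norm_single one_pos]; simp

theorem hasSum_norm (f : L1 S) : HasSum (fun s => ‖f s‖) ‖f‖ := by
  simpa using lp.hasSum_norm (by simp) f

theorem hasSum_delta (f : L1 S) : HasSum (fun s => f s • delta s) f := by
  classical
  convert lp.hasSum_single (by simp) f using 2 with s
  rw [delta, ← lp.single_smul]; simp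

/-- Bounded linear maps on `ℓ¹(S)` that agree on point masses are equal. -/
theorem clm_ext {F : Type*} [NormedAddCommGroup F] [NormedSpace ℂ F] {T U : L1 S →L[ℂ] F}
    (h : ∀ s, T (delta s) = U (delta s)) : T = U := by
  ext f
  have h1 := (hasSum_delta f).mapL T
  have h2 := (hasSum_delta f).mapL U
  simp only [map_smul, h] at h1 h2
  exact h1.unique h2

variable [Semigroup S]

theorem summable_norm_conv (f g : L1 S) :
    Summable fun p : S × S => ‖(f p.1 * g p.2) • delta (p.1 * p.2)‖ := by
  simpa [norm_smul] using
    (hasSum_norm f).summable.mul_of_nonneg (hasSum_norm g).summable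
      (fun _ => norm_nonneg _) (fun _ => norm_nonneg _)

theorem summable_conv (f g : L1 S) :
    Summable fun p : S × S => (f p.1 * g p.2) • delta (p.1 * p.2) :=
  (summable_norm_conv f g).of_norm

/-- Convolution: `f * g = ∑_{s, t} f(s) g(t) δ_{st}`. -/
instance : Mul (L1 S) where
  mul f g := ∑' p : S × S, (f p.1 * g p.2) • delta (p.1 * p.2)

theorem mul_def (f g : L1 S) :
    f * g = ∑' p : S × S, (f p.1 * g p.2) • delta (p.1 * p.2) := rfl

theorem norm_mul_le' (f g : L1 S) : ‖f * g‖ ≤ ‖f‖ * ‖g‖ := by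
  refine (norm_tsum_le_tsum_norm (summable_norm_conv f g)).trans_eq ?_
  have h := (hasSum_norm f).mul (hasSum_norm g)
    ((hasSum_norm f).summable.mul_of_nonneg (hasSum_norm g).summable
      (fun _ => norm_nonneg _) (fun _ => norm_nonneg _))
  simpa [norm_smul] using h.tsum_eq

theorem add_mul' (f g h : L1 S) : (f + g) * h = f * h + g * h := by
  rw [mul_def, mul_def, mul_def, ← (summable_conv f h).tsum_add (summable_conv g h)]
  simp [add_mul, add_smul]

theorem mul_add' (f g h : L1 S) : f * (g + h) = f * g + f * h := by
  rw [mul_def, mul_def, mul_def, ← (summable_conv f g).tsum_add (summable_conv f h)]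
  simp [mul_add, add_smul]

theorem smul_mul' (c : ℂ) (f g : L1 S) : (c • f) * g = c • (f * g) := by
  rw [mul_def, mul_def, ← (summable_conv f g).tsum_const_smul]
  simp [mul_assoc, smul_smul]

theorem mul_smul' (c : ℂ) (f g : L1 S) : f * (c • g) = c • (f * g) := by
  rw [mul_def, mul_def, ← (summable_conv f g).tsum_const_smul]
  simp [mul_left_comm, smul_smul]

/-- Convolution as a bounded bilinear map. -/
def conv : L1 S →L[ℂ] L1 S →L[ℂ] L1 S :=
  LinearMap.mkContinuous₂ (LinearMap.mk₂ ℂ (fun f g : L1 S => f * g) add_mul' smul_mul' mul_add'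
    mul_smul') 1 (fun f g => by simpa using norm_mul_le' f g)

theorem conv_apply (f g : L1 S) : conv f g = f * g := rfl

theorem delta_mul_delta (s t : S) : delta s * delta t = delta (s * t) := by
  rw [mul_def, tsum_eq_single (s, t)]
  · simp
  · rintro ⟨a, b⟩ h
    by_cases ha : a = s
    · have hb : b ≠ t := fun hb => h (by rw [ha, hb])
      simp [delta_apply_ne hb]
    · simp [delta_apply_ne ha]

theorem mul_assoc' (f g h : L1 S) : f * g * h = f * (g * h) := by
  have h1 : ∀ (s t u : S), delta s * delta t * delta u = delta s * (delta t * delta u) := by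
    intro s t u
    simp only [delta_mul_delta, mul_assoc]
  have h2 : ∀ (f : L1 S) (t u : S), f * delta t * delta u = f * (delta t * delta u) := by
    intro f t u
    have : (conv.flip (delta u)).comp (conv.flip (delta t)) =
        conv.flip (delta t * delta u) := clm_ext fun s => h1 s t u
    exact congrArg (fun T => T f) this
  have h3 : ∀ (f g : L1 S) (u : S), f * g * delta u = f * (g * delta u) := by
    intro f g u
    have : (conv.flip (delta u)).comp (conv f) = (conv f).comp (conv.flip (delta u)) :=
      clm_ext fun t => h2 f t u
    exact congrArg (fun T => T g) this
  have : conv (f * g) = (conv f).comp (conv g) := clm_ext fun u => h3 f g u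
  exact congrArg (fun T => T h) this

instance : NonUnitalNormedRing (L1 S) :=
  { (inferInstance : NormedAddCommGroup (L1 S)), (inferInstance : Mul (L1 S)) with
    left_distrib := mul_add'
    right_distrib := add_mul'
    zero_mul := fun f => by simpa using smul_mul' 0 f f
    mul_zero := fun f => by simpa using mul_smul' 0 f f
    mul_assoc := mul_assoc'
    norm_mul_le := norm_mul_le' }

instance : IsScalarTower ℂ (L1 S) (L1 S) := ⟨smul_mul'⟩

instance : SMulCommClass ℂ (L1 S) (L1 S) := ⟨fun c f g => (mul_smul' c f g).symm⟩

/-- Convolution evaluated at a point. -/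
theorem mul_apply (f g : L1 S) (u : S) :
    (f * g) u = ∑' p : S × S, f p.1 * g p.2 * delta (p.1 * p.2) u := by
  have h := (summable_conv f g).hasSum.mapL (lp.evalCLM ℂ (fun _ : S => ℂ) 1 u)
  exact h.tsum_eq.symm

end L1

/-! ### Triangular Banach algebras -/

/-- The triangular algebra of the matrices `[a m; 0 b]` with entries in `A`, with the norm
`‖a‖ + ‖m‖ + ‖b‖`. -/
abbrev Tri (A : Type u) : Type u := WithLp 1 (A × WithLp 1 (A × A))

namespace Tri

variable {A : Type u}

/-- The matrix `[a m; 0 b]`. -/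
def mk (a m b : A) : Tri A := WithLp.toLp 1 (a, WithLp.toLp 1 (m, b))

/-- The upper left entry. -/
def e₁₁ (t : Tri A) : A := t.fst
/-- The upper right entry. -/
def e₁₂ (t : Tri A) : A := t.snd.fst
/-- The lower right entry. -/
def e₂₂ (t : Tri A) : A := t.snd.snd

@[simp] theorem e₁₁_mk (a m b : A) : (mk a m b).e₁₁ = a := rfl
@[simp] theorem e₁₂_mk (a m b : A) : (mk a m b).e₁₂ = m := rfl
@[simp] theorem e₂₂_mk (a m b : A) : (mk a m b).e₂₂ = b := rfl

@[ext] theorem ext {s t : Tri A} (h₁ : s.e₁₁ = t.e₁₁) (h₂ : s.e₁₂ = t.e₁₂)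
    (h₃ : s.e₂₂ = t.e₂₂) : s = t := by
  apply WithLp.ofLp_injective
  apply Prod.ext h₁
  apply WithLp.ofLp_injective
  exact Prod.ext h₂ h₃

variable [NonUnitalNormedRing A]

@[simp] theorem e₁₁_add (s t : Tri A) : (s + t).e₁₁ = s.e₁₁ + t.e₁₁ := rfl
@[simp] theorem e₁₂_add (s t : Tri A) : (s + t).e₁₂ = s.e₁₂ + t.e₁₂ := rfl
@[simp] theorem e₂₂_add (s t : Tri A) : (s + t).e₂₂ = s.e₂₂ + t.e₂₂ := rfl
@[simp] theorem e₁₁_zero : (0 : Tri A).e₁₁ = 0 := rfl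
@[simp] theorem e₁₂_zero : (0 : Tri A).e₁₂ = 0 := rfl
@[simp] theorem e₂₂_zero : (0 : Tri A).e₂₂ = 0 := rfl

theorem norm_eq (t : Tri A) : ‖t‖ = ‖t.e₁₁‖ + ‖t.e₁₂‖ + ‖t.e₂₂‖ := by
  rw [WithLp.prod_norm_eq_of_L1, WithLp.prod_norm_eq_of_L1, ← add_assoc]
  rfl

/-- Matrix multiplication. -/
instance : Mul (Tri A) where
  mul s t := mk (s.e₁₁ * t.e₁₁) (s.e₁₁ * t.e₁₂ + s.e₁₂ * t.e₂₂) (s.e₂₂ * t.e₂₂)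

@[simp] theorem e₁₁_mul (s t : Tri A) : (s * t).e₁₁ = s.e₁₁ * t.e₁₁ := rfl
@[simp] theorem e₁₂_mul (s t : Tri A) : (s * t).e₁₂ = s.e₁₁ * t.e₁₂ + s.e₁₂ * t.e₂₂ := rfl
@[simp] theorem e₂₂_mul (s t : Tri A) : (s * t).e₂₂ = s.e₂₂ * t.e₂₂ := rfl

instance : NonUnitalNormedRing (Tri A) :=
  { (inferInstance : NormedAddCommGroup (Tri A)), (inferInstance : Mul (Tri A)) with
    left_distrib := fun a b c => by ext <;> simp [mul_add]; abel
    right_distrib := fun a b c => by ext <;> simp [add_mul]; abel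
    zero_mul := fun a => by ext <;> simp
    mul_zero := fun a => by ext <;> simp
    mul_assoc := fun a b c => by ext <;> simp [mul_add, add_mul, mul_assoc, add_assoc]
    norm_mul_le := fun s t => by
      simp only [norm_eq, e₁₁_mul, e₁₂_mul, e₂₂_mul]
      have h1 := norm_mul_le s.e₁₁ t.e₁₁
      have h2 := norm_add_le (s.e₁₁ * t.e₁₂) (s.e₁₂ * t.e₂₂)
      have h3 := norm_mul_le s.e₁₁ t.e₁₂
      have h4 := norm_mul_le s.e₁₂ t.e₂₂
      have h5 := norm_mul_le s.e₂₂ t.e₂₂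
      have p1 : 0 ≤ ‖s.e₁₁‖ * ‖t.e₂₂‖ := by positivity
      have p2 : 0 ≤ ‖s.e₁₂‖ * ‖t.e₁₁‖ := by positivity
      have p3 : 0 ≤ ‖s.e₁₂‖ * ‖t.e₁₂‖ := by positivity
      have p4 : 0 ≤ ‖s.e₂₂‖ * ‖t.e₁₁‖ := by positivity
      have p5 : 0 ≤ ‖s.e₂₂‖ * ‖t.e₁₂‖ := by positivity
      nlinarith }

variable [NormedSpace ℂ A]

@[simp] theorem e₁₁_smul (c : ℂ) (t : Tri A) : (c • t).e₁₁ = c • t.e₁₁ := rfl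
@[simp] theorem e₁₂_smul (c : ℂ) (t : Tri A) : (c • t).e₁₂ = c • t.e₁₂ := rfl
@[simp] theorem e₂₂_smul (c : ℂ) (t : Tri A) : (c • t).e₂₂ = c • t.e₂₂ := rfl

instance [IsScalarTower ℂ A A] : IsScalarTower ℂ (Tri A) (Tri A) :=
  ⟨fun c s t => by ext <;> simp [smul_mul_assoc]⟩

instance [SMulCommClass ℂ A A] : SMulCommClass ℂ (Tri A) (Tri A) :=
  ⟨fun c s t => by ext <;> simp [mul_smul_comm]⟩

/-- The algebra of the diagonal matrices `[α 0; 0 α]` with `α` in a subalgebra `B` of `A`. -/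
def diagonal (B : NonUnitalSubalgebra ℂ A) : NonUnitalSubalgebra ℂ (Tri A) where
  carrier := {t | ∃ α ∈ B, t = mk α 0 α}
  add_mem' := by
    rintro _ _ ⟨α, hα, rfl⟩ ⟨β, hβ, rfl⟩
    exact ⟨α + β, B.add_mem hα hβ, by ext <;> simp⟩
  zero_mem' := ⟨0, B.zero_mem, by ext <;> simp⟩
  mul_mem' := by
    rintro _ _ ⟨α, hα, rfl⟩ ⟨β, hβ, rfl⟩
    exact ⟨α * β, B.mul_mem hα hβ, by ext <;> simp⟩
  smul_mem' := by
    rintro c _ ⟨α, hα, rfl⟩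
    exact ⟨c • α, SMulMemClass.smul_mem c hα, by ext <;> simp⟩

theorem isClosed_diagonal {B : NonUnitalSubalgebra ℂ A} (hB : IsClosed (B : Set A)) :
    IsClosed (diagonal B : Set (Tri A)) := by
  have c1 : Continuous (e₁₁ : Tri A → A) :=
    LipschitzWith.continuous (K := 1) (LipschitzWith.of_dist_le_mul fun s t => by
      rw [dist_eq_norm, dist_eq_norm, NNReal.coe_one, one_mul, norm_eq (s - t)]
      change ‖(s - t).e₁₁‖ ≤ _
      linarith [norm_nonneg (s - t).e₁₂, norm_nonneg (s - t).e₂₂])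
  have c2 : Continuous (e₁₂ : Tri A → A) :=
    LipschitzWith.continuous (K := 1) (LipschitzWith.of_dist_le_mul fun s t => by
      rw [dist_eq_norm, dist_eq_norm, NNReal.coe_one, one_mul, norm_eq (s - t)]
      change ‖(s - t).e₁₂‖ ≤ _
      linarith [norm_nonneg (s - t).e₁₁, norm_nonneg (s - t).e₂₂])
  have c3 : Continuous (e₂₂ : Tri A → A) :=
    LipschitzWith.continuous (K := 1) (LipschitzWith.of_dist_le_mul fun s t => by
      rw [dist_eq_norm, dist_eq_norm, NNReal.coe_one, one_mul, norm_eq (s - t)]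
      change ‖(s - t).e₂₂‖ ≤ _
      linarith [norm_nonneg (s - t).e₁₁, norm_nonneg (s - t).e₁₂])
  have : (diagonal B : Set (Tri A)) =
      e₁₁ ⁻¹' (B : Set A) ∩ ({t | t.e₁₂ = 0} ∩ {t | t.e₂₂ = t.e₁₁}) := by
    ext t
    constructor
    · rintro ⟨α, hα, rfl⟩
      exact ⟨hα, rfl, rfl⟩
    · rintro ⟨h1, h2, h3⟩
      exact ⟨t.e₁₁, h1, by ext; exacts [rfl, h2, h3]⟩
  rw [this]
  exact (hB.preimage c1).inter ((isClosed_eq c2 continuous_const).inter (isClosed_eq c3 c1))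

end Tri

/-! ### Inverse semigroups -/

/-- `S` is an inverse semigroup: each `s` has a unique `t` with `sts = s` and `tst = t`. -/
def IsInverseSemigroup (S : Type u) [Semigroup S] : Prop :=
  ∀ s : S, ∃! t : S, s * t * s = s ∧ t * s * t = t

/-- The set `E` of idempotents of `S`. -/
def idempotents (S : Type u) [Semigroup S] : Set S := {e | e * e = e}

/-- The Duncan–Namioka condition `D_k` for the set of idempotents `E` of `S`. -/
def SatisfiesD (S : Type u) [Semigroup S] (k : ℕ) : Prop :=
  ∀ f : Fin (k + 1) → S, (∀ i, f i ∈ idempotents S) →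
    ∃ e ∈ idempotents S, ∃ i j : Fin (k + 1), i < j ∧ f i * e = f i ∧ f j * e = f j

section Commutative

variable (S : Type u) [CommSemigroup S]

theorem mul_mem_idempotents {e f : S} (he : e ∈ idempotents S) (hf : f ∈ idempotents S) :
    e * f ∈ idempotents S := by
  change e * f * (e * f) = e * f
  rw [mul_mul_mul_comm, show e * e = e from he, show f * f = f from hf]

/-- `ℓ¹(E)`, as the subalgebra of the functions in `ℓ¹(S)` that vanish off `E`. -/
def l1E : NonUnitalSubalgebra ℂ (L1 S) where
  carrier := {f | ∀ s, s ∉ idempotents S → f s = 0}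
  add_mem' := by
    intro f g hf hg s hs
    simp [hf s hs, hg s hs]
  zero_mem' := fun s _ => by simp
  mul_mem' := by
    intro f g hf hg u hu
    rw [L1.mul_apply]
    refine (tsum_congr fun p => ?_).trans tsum_zero
    by_cases h1 : p.1 ∈ idempotents S
    · by_cases h2 : p.2 ∈ idempotents S
      · have : u ≠ p.1 * p.2 := fun h => hu (h ▸ mul_mem_idempotents S h1 h2)
        rw [L1.delta_apply_ne this, mul_zero]
      · rw [hg _ h2, mul_zero, zero_mul]
    · rw [hf _ h1, zero_mul, zero_mul]
  smul_mem' := by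
    intro c f hf s hs
    simp [hf s hs]

theorem isClosed_l1E : IsClosed (l1E S : Set (L1 S)) := by
  have : (l1E S : Set (L1 S)) =
      ⋂ s ∈ {s | s ∉ idempotents S}, {f | lp.evalCLM ℂ (fun _ : S => ℂ) 1 s f = 0} := by
    ext f
    simp only [Set.mem_iInter]
    exact Iff.rfl
  rw [this]
  exact isClosed_biInter fun s _ => isClosed_eq (ContinuousLinearMap.continuous _)
    continuous_const

/-- `𝔗₀` is a Banach algebra. -/
instance : CompleteSpace (Tri.diagonal (l1E S)) :=
  (Tri.isClosed_diagonal (isClosed_l1E S)).completeSpace_coe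

/-- `𝒯₀ = [ℓ¹(S) ℓ¹(S); 0 ℓ¹(S)]` as a bimodule over the algebra `𝔗₀` of the diagonal matrices
`[α 0; 0 α]` with `α` in `ℓ¹(E)`, acting by matrix multiplication. -/
def T₀ : BanachAlgebraBimodule (Tri (L1 S)) (Tri.diagonal (l1E S)) :=
  BanachAlgebraBimodule.ofSubalgebra (Tri.diagonal (l1E S))

end Commutative

end

noncomputable section

/-! ### Idempotents of inverse semigroups -/

/-! The ideal $J$ is zero, because the scalars $\alpha I$ act by multiplication inside the
associative algebra $\mathcal T_0$. Its duals are therefore triples over the corresponding duals of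
$\ell^1(S)$, and the action alternates between that on triangular matrices and its transpose. The
scalars are central, so every dual is commutative.

A module derivation is automatically $\mathbb C$-linear: $\delta_s=\delta_{s^*s}\delta_s$, and
multiples of $\delta_{s^*s}I$ are scalars of the module. Testing the Leibniz rule on products of
single matrix entries then splits it into maps of $\ell^1(S)$ into a symmetric module. Three facts
settle them. A map that kills products is zero, since every point mass is a product
(`SymmetricModule.eq_zero_of_map_mul`). A bounded derivation is zero
(`SymmetricModule.derivation_eq_zero`): $s^*\cdot\varphi(\delta_s)$ behaves like a logarithmic
derivative, and its multiples along powers of $s$ stay bounded. A module map into a dual is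
$a\mapsto a\cdot g$ (`SymmetricModule.exists_eq_act`).

Only the third fact uses $D_k$. The condition lets at most $k$ idempotents dominate any finite set
of them, which gives identities for finite sets of idempotents with norms bounded by $2^k$; $g$ is a
weak* limit of the images of these. The resulting elements $g$ assemble into the one that implements
the derivation. -/

theorem IsInverseSemigroup.exists_idempotent {S : Type u} [CommSemigroup S]
    (hS : IsInverseSemigroup S) (s : S) :
    ∃ e ∈ idempotents S, ∃ t : S, e * s = s ∧ e * t = t ∧ t * s = e := by
  obtain ⟨t, ⟨h1, h2⟩, -⟩ := hS s
  refine ⟨t * s, ?_, t, ?_, h2, rfl⟩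
  · change t * s * (t * s) = t * s
    rw [← mul_assoc, h2]
  · rw [mul_comm t s, h1]

/-- Under `D_k`, finitely many idempotents are dominated by at most `k` idempotents. -/
theorem SatisfiesD.exists_dominating {S : Type u} [CommSemigroup S] {k : ℕ}
    (hD : SatisfiesD S k) (F : Finset S) (hF : ∀ f ∈ F, f ∈ idempotents S) :
    ∃ G : Finset S, G.card ≤ k ∧ (∀ g ∈ G, g ∈ idempotents S) ∧ ∀ f ∈ F, ∃ g ∈ G, f * g = f := by
  classical
  -- A dominating set of least size is taken. With more than $k$ elements, $D_k$ would put two of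
  -- them under a single idempotent and so give a smaller dominating set.
  let p : ℕ → Prop := fun n => ∃ G : Finset S, G.card = n ∧ (∀ g ∈ G, g ∈ idempotents S) ∧
    ∀ f ∈ F, ∃ g ∈ G, f * g = f
  have hp : ∃ n, p n := ⟨F.card, F, rfl, hF, fun f hf => ⟨f, hf, hF f hf⟩⟩
  obtain ⟨G, hc, hG, hFG⟩ := Nat.find_spec hp
  refine ⟨G, ?_, hG, hFG⟩
  by_contra! hk
  let φ : Fin (k + 1) → S := fun i => (G.equivFin.symm (Fin.castLE hk i) : S)
  have hφ : ∀ i, φ i ∈ G := fun i => (G.equivFin.symm (Fin.castLE hk i)).2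
  have hinj : Function.Injective φ := fun i j h =>
    Fin.castLE_injective hk (G.equivFin.symm.injective (Subtype.ext h))
  obtain ⟨e, he, i, j, hij, hi, hj⟩ := hD φ fun i => hG _ (hφ i)
  have hne : φ j ≠ φ i := fun h => hij.ne' (hinj h)
  -- Two distinct elements are erased and at most one is inserted, so the size drops.
  refine Nat.find_min hp (m := (insert e ((G.erase (φ i)).erase (φ j))).card) ?_
    ⟨_, rfl, ?_, ?_⟩
  · rw [← hc]
    have h1 := Finset.card_insert_le e ((G.erase (φ i)).erase (φ j))
    have h2 := Finset.card_erase_add_one (Finset.mem_erase.2 ⟨hne, hφ j⟩)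
    have h3 := Finset.card_erase_add_one (hφ i)
    omega
  · intro g hg
    rcases Finset.mem_insert.1 hg with rfl | hg
    · exact he
    · exact hG g (Finset.mem_of_mem_erase (Finset.mem_of_mem_erase hg))
  · intro f hf
    obtain ⟨g, hg, hfg⟩ := hFG f hf
    by_cases h1 : g = φ i
    · exact ⟨e, Finset.mem_insert_self _ _, by rw [← hfg, h1, mul_assoc, hi]⟩
    by_cases h2 : g = φ j
    · exact ⟨e, Finset.mem_insert_self _ _, by rw [← hfg, h2, mul_assoc, hj]⟩
    exact ⟨g, Finset.mem_insert_of_mem (Finset.mem_erase.2 ⟨h2, Finset.mem_erase.2 ⟨h1, hg⟩⟩),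
      hfg⟩

/-! ### Bounded identities for finite sets of idempotents -/

namespace L1

theorem mul_comm' {S : Type u} [CommSemigroup S] (f g : L1 S) : f * g = g * f := by
  rw [mul_def, mul_def, ← (Equiv.prodComm S S).tsum_eq]
  simp [mul_comm]

/-- A function in `ℓ¹(S)` of norm at most `2 ^ n - 1` that is an identity for `n` given
idempotents. -/
theorem exists_identity {S : Type u} [CommSemigroup S] (G : Finset S)
    (hG : ∀ g ∈ G, g ∈ idempotents S) :
    ∃ u : L1 S, ‖u‖ + 1 ≤ 2 ^ G.card ∧ ∀ g ∈ G, u * delta g = delta g := by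
  classical
  induction G using Finset.induction_on with
  | empty => exact ⟨0, by simp, by simp⟩
  | insert a G ha ih =>
    obtain ⟨u, hu, h⟩ := ih fun g hg => hG g (Finset.mem_insert_of_mem hg)
    -- In the unitization this is $1-(1-u)(1-\delta_a)$, so each factor kills its own idempotents.
    -- Adding one idempotent at most doubles $\|u\|+1$, which explains the form of the bound.
    refine ⟨u + delta a - u * delta a, ?_, ?_⟩
    · have h1 := norm_sub_le (u + delta a) (u * delta a)
      have h2 := norm_add_le u (delta a)
      have h3 := norm_mul_le u (delta a)
      rw [norm_delta] at h2 h3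
      rw [Finset.card_insert_of_notMem ha, pow_succ]
      linarith
    · intro g hg
      rcases Finset.mem_insert.1 hg with rfl | hg
      · have : delta g * delta g = delta g := by
          rw [delta_mul_delta, show g * g = g from hG _ (Finset.mem_insert_self _ _)]
        rw [sub_mul, add_mul, mul_assoc, this]
        abel
      · rw [sub_mul, add_mul, mul_assoc, mul_comm' (delta a), ← mul_assoc, h g hg]
        abel

/-- An identity for $\delta_g$ is one for every $\delta_f$ with $fg=f$. It thus suffices to treat a
dominating set of size at most $k$, and the bound does not depend on `F`. -/
theorem exists_identity_of_satisfiesD {S : Type u} [CommSemigroup S] {k : ℕ}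
    (hD : SatisfiesD S k) (F : Finset S) :
    ∃ u : L1 S, ‖u‖ ≤ 2 ^ k ∧ ∀ f ∈ F, f ∈ idempotents S → u * delta f = delta f := by
  classical
  obtain ⟨G, hk, hG, hFG⟩ := hD.exists_dominating (F.filter (· ∈ idempotents S))
    fun f hf => (Finset.mem_filter.1 hf).2
  obtain ⟨u, hu, h⟩ := exists_identity G hG
  refine ⟨u, ?_, fun f hf hf' => ?_⟩
  · have : (2 : ℝ) ^ G.card ≤ 2 ^ k := pow_le_pow_right₀ one_le_two hk
    linarith
  · obtain ⟨g, hg, hfg⟩ := hFG f (Finset.mem_filter.2 ⟨hf, hf'⟩)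
    rw [← hfg, mul_comm f g, ← delta_mul_delta, ← mul_assoc, h g hg]

end L1

/-! ### Symmetric Banach modules over a commutative Banach algebra -/

/-- A Banach space with a commuting bounded action of a Banach algebra `A`. -/
structure SymmetricModule (A : Type u) [NonUnitalNormedRing A] [NormedSpace ℂ A] where
  carrier : Type u
  [normedAddCommGroup : NormedAddCommGroup carrier]
  [normedSpace : NormedSpace ℂ carrier]
  [completeSpace : CompleteSpace carrier]
  act : A →L[ℂ] carrier →L[ℂ] carrier
  act_mul : ∀ a b y, act (a * b) y = act a (act b y)
  act_comm : ∀ a b y, act a (act b y) = act b (act a y)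

namespace SymmetricModule

attribute [instance] normedAddCommGroup normedSpace completeSpace

/-- The dual of a symmetric module. -/
def dual {A : Type u} [NonUnitalNormedRing A] [NormedSpace ℂ A] (Y : SymmetricModule A) :
    SymmetricModule A where
  carrier := StrongDual ℂ Y.carrier
  act := BanachModule.transpose Y.act
  act_mul a b f := by ext x; simp [Y.act_mul, Y.act_comm a b]
  act_comm a b f := by ext x; simp [Y.act_comm a b]

/-! ### Maps from $\ell^1(S)$ into symmetric modules -/

variable {S : Type u} [CommSemigroup S]

/-- Bounded linear maps that vanish on all products vanish. -/
theorem eq_zero_of_map_mul (hS : IsInverseSemigroup S) {Y : Type*}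
    [NormedAddCommGroup Y] [NormedSpace ℂ Y] (φ : L1 S →L[ℂ] Y) (h : ∀ a b, φ (a * b) = 0) : φ = 0 := by
  refine L1.clm_ext fun s => ?_
  obtain ⟨e, -, t, hs, -⟩ := hS.exists_idempotent s
  rw [← hs, ← L1.delta_mul_delta, h]
  rfl

/-- Bounded derivations of `ℓ¹(S)` into symmetric modules vanish. -/
theorem derivation_eq_zero (hS : IsInverseSemigroup S) (Y : SymmetricModule (L1 S))
    (φ : L1 S →L[ℂ] Y.carrier) (h : ∀ a b, φ (a * b) = Y.act b (φ a) + Y.act a (φ b)) : φ = 0 := by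
  have hm : ∀ s t y, Y.act (L1.delta (s * t)) y = Y.act (L1.delta s) (Y.act (L1.delta t) y) := by
    intro s t y
    rw [← L1.delta_mul_delta, Y.act_mul]
  have hd : ∀ s t, φ (L1.delta (s * t)) =
      Y.act (L1.delta t) (φ (L1.delta s)) + Y.act (L1.delta s) (φ (L1.delta t)) := by
    intro s t
    rw [← L1.delta_mul_delta, h]
  refine L1.clm_ext fun s => ?_
  obtain ⟨e, he, t, hs, ht, hts⟩ := hS.exists_idempotent s
  have hee : e * e = e := he
  -- From $\varphi(\delta_e)=2\,e\cdot\varphi(\delta_e)$, acting by $e$ gives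
  -- $e\cdot\varphi(\delta_e)=2\,e\cdot\varphi(\delta_e)$. Hence $e\cdot\varphi(\delta_e)=0$, and so
  -- $\varphi(\delta_e)=0$.
  have hφe : φ (L1.delta e) = 0 := by
    have h1 := hd e e
    rw [hee] at h1
    have h2 := congrArg (Y.act (L1.delta e)) h1
    rw [map_add, ← hm, hee, left_eq_add] at h2
    rw [h1, h2, add_zero]
  have hφs : φ (L1.delta s) = Y.act (L1.delta e) (φ (L1.delta s)) := by
    conv_lhs => rw [← hs, hd, hφe, map_zero, zero_add]
  set x := Y.act (L1.delta t) (φ (L1.delta s)) with hx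
  -- The pair is $p=es^n$, $q=et^n$. The logarithmic derivative $q\cdot\varphi(\delta_p)$ is
  -- additive in $n$, while point masses have norm one; this forces $x=0$.
  have key : ∀ n : ℕ, ∃ p q : S, e * p = p ∧ e * q = q ∧ q * p = e ∧
      Y.act (L1.delta q) (φ (L1.delta p)) = n • x := by
    intro n
    induction n with
    | zero => exact ⟨e, e, hee, hee, hee, by simp [hφe]⟩
    | succ n ih =>
      obtain ⟨p, q, hp, hq, hqp, hn⟩ := ih
      refine ⟨p * s, q * t, by rw [← mul_assoc, hp], by rw [← mul_assoc, hq], ?_, ?_⟩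
      · rw [mul_mul_mul_comm, hqp, hts, hee]
      · have h1 : q * t * s = q := by rw [mul_assoc, hts, mul_comm, hq]
        have h2 : q * t * p = t := by rw [mul_right_comm, hqp, ht]
        rw [hd, map_add, ← hm, ← hm, h1, h2, hn, succ_nsmul]
  have hbd : ∀ n : ℕ, n * ‖x‖ ≤ ‖Y.act‖ * ‖φ‖ := by
    intro n
    obtain ⟨p, q, -, -, -, hn⟩ := key n
    calc n * ‖x‖ = ‖n • x‖ := by rw [← Nat.cast_smul_eq_nsmul ℂ, norm_smul]; simp
      _ ≤ ‖Y.act‖ * ‖L1.delta q‖ * ‖φ (L1.delta p)‖ := hn ▸ Y.act.le_opNorm₂ _ _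
      _ ≤ ‖Y.act‖ * 1 * (‖φ‖ * ‖L1.delta p‖) := by
        rw [L1.norm_delta]; gcongr; exact φ.le_opNorm _
      _ = ‖Y.act‖ * ‖φ‖ := by rw [L1.norm_delta]; ring
  have hx0 : x = 0 := by
    by_contra hne
    have hpos := norm_pos_iff.2 hne
    obtain ⟨n, hn⟩ := exists_nat_gt (‖Y.act‖ * ‖φ‖ / ‖x‖)
    rw [div_lt_iff₀ hpos] at hn
    exact (hbd n).not_gt hn
  rw [hφs, ← hts, mul_comm, hm, ← hx, hx0, map_zero]
  rfl

/-- Under `D_k`, module maps of `ℓ¹(S)` into dual modules are given by elements of the module. -/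
theorem exists_eq_act (hS : IsInverseSemigroup S) {k : ℕ} (hD : SatisfiesD S k)
    (Y : SymmetricModule (L1 S)) (φ : L1 S →L[ℂ] Y.dual.carrier)
    (h : ∀ a b, φ (a * b) = Y.dual.act a (φ b)) :
    ∃ g : Y.dual.carrier, ∀ a, φ a = Y.dual.act a g := by
  -- The net is indexed by the finite subsets of `S`. Its images under `φ` stay in a fixed ball,
  -- which is weak* compact, so they converge along an ultrafilter finer than `atTop`.
  choose w hw hw' using L1.exists_identity_of_satisfiesD hD
  let ψ : Finset S → WeakDual ℂ Y.carrier := fun F => StrongDual.toWeakDual (φ (w F))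
  have hψ : ∀ F, ψ F ∈ WeakDual.toStrongDual ⁻¹'
      Metric.closedBall (0 : StrongDual ℂ Y.carrier) (‖φ‖ * 2 ^ k) := by
    intro F
    have : ‖φ (w F)‖ ≤ ‖φ‖ * 2 ^ k :=
      (φ.le_opNorm _).trans (mul_le_mul_of_nonneg_left (hw F) (norm_nonneg _))
    exact mem_closedBall_zero_iff.2 this
  let U : Ultrafilter (Finset S) := Ultrafilter.of Filter.atTop
  obtain ⟨g, -, hg⟩ := (WeakDual.isCompact_closedBall (0 : StrongDual ℂ Y.carrier)
    (‖φ‖ * 2 ^ k)).ultrafilter_le_nhds (U.map ψ)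
    (Filter.le_principal_iff.2 (Filter.mem_map.2 (Filter.univ_mem' hψ)))
  have hlim : ∀ z, Filter.Tendsto (fun F => ψ F z) U (nhds (g z)) := fun z =>
    ((WeakDual.eval_continuous z).tendsto g).comp hg
  let g' : Y.dual.carrier := WeakDual.toStrongDual g
  -- As soon as $e\in F$, $\varphi(\delta_e)=\varphi(\delta_e w_F)=\delta_e\cdot\varphi(w_F)$. The
  -- action on a dual is weak* continuous, so the limit can be taken.
  have hE : ∀ e ∈ idempotents S, φ (L1.delta e) = Y.dual.act (L1.delta e) g' := by
    intro e he
    refine ContinuousLinearMap.ext fun z => ?_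
    refine tendsto_nhds_unique (f := fun F => ψ F (Y.act (L1.delta e) z)) (l := (U : Filter _))
      ?_ (hlim (Y.act (L1.delta e) z))
    refine tendsto_const_nhds.congr' ?_
    have : ∀ᶠ F : Finset S in Filter.atTop, e ∈ F :=
      (Filter.eventually_ge_atTop {e}).mono fun F hF => hF (Finset.mem_singleton_self e)
    have hU : ∀ᶠ F in (U : Filter (Finset S)), e ∈ F := Ultrafilter.of_le _ this
    refine hU.mono fun F hF => ?_
    have h1 := h (L1.delta e) (w F)
    rw [L1.mul_comm', hw' F e hF he] at h1
    exact congrArg (fun f : StrongDual ℂ Y.carrier => f z) h1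
  refine ⟨g', fun a => ?_⟩
  -- The idempotent case suffices, since $\varphi(\delta_s)=\delta_s\cdot\varphi(\delta_e)$ when
  -- $es=s$.
  have : φ = Y.dual.act.flip g' := by
    refine L1.clm_ext fun s => ?_
    obtain ⟨e, he, t, hs, -⟩ := hS.exists_idempotent s
    rw [ContinuousLinearMap.flip_apply, ← hs, mul_comm, ← L1.delta_mul_delta, h, hE e he,
      Y.dual.act_mul]
  rw [this]; rfl

end SymmetricModule

/-! ### The duals of `𝒯₀ ⧸ J` as spaces of matrices -/

namespace BanachModule

variable {S : Type u} [CommSemigroup S]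

/-- An identification of `X` with the upper triangular matrices `[p q; 0 r]` over `Y`. -/
structure TriangularForm (X : BanachModule (T₀ S)) (Y : SymmetricModule (L1 S)) where
  equiv : (Y.carrier × Y.carrier × Y.carrier) ≃L[ℂ] X.carrier
  left_equiv : ∀ x p, X.left x (equiv p) =
    equiv (Y.act x.e₁₁ p.1, Y.act x.e₁₁ p.2.1 + Y.act x.e₁₂ p.2.2, Y.act x.e₂₂ p.2.2)
  right_equiv : ∀ x p, X.right x (equiv p) =
    equiv (Y.act x.e₁₁ p.1, Y.act x.e₁₂ p.1 + Y.act x.e₂₂ p.2.1, Y.act x.e₂₂ p.2.2)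

/-- An identification of `X` with `Y × Y × Y` under which the actions are the transposes of those
on triangular matrices. -/
structure CotriangularForm (X : BanachModule (T₀ S)) (Y : SymmetricModule (L1 S)) where
  equiv : (Y.carrier × Y.carrier × Y.carrier) ≃L[ℂ] X.carrier
  left_equiv : ∀ x p, X.left x (equiv p) =
    equiv (Y.act x.e₁₁ p.1 + Y.act x.e₁₂ p.2.1, Y.act x.e₂₂ p.2.1, Y.act x.e₂₂ p.2.2)
  right_equiv : ∀ x p, X.right x (equiv p) =
    equiv (Y.act x.e₁₁ p.1, Y.act x.e₁₁ p.2.1, Y.act x.e₁₂ p.2.1 + Y.act x.e₂₂ p.2.2)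

/-- The dual of a space identified with `Y × Y × Y`. -/
def dualEquiv {X Y : Type*} [NormedAddCommGroup X] [NormedSpace ℂ X] [NormedAddCommGroup Y]
    [NormedSpace ℂ Y] (e : (Y × Y × Y) ≃L[ℂ] X) :
    (StrongDual ℂ Y × StrongDual ℂ Y × StrongDual ℂ Y) ≃L[ℂ] StrongDual ℂ X :=
  (((ContinuousLinearEquiv.refl ℂ (StrongDual ℂ Y)).prodCongr
    (ContinuousLinearMap.coprodEquivL ℂ)).trans (ContinuousLinearMap.coprodEquivL ℂ)).trans
      (e.arrowCongr (ContinuousLinearEquiv.refl ℂ ℂ))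

theorem dualEquiv_apply {X Y : Type*} [NormedAddCommGroup X] [NormedSpace ℂ X]
    [NormedAddCommGroup Y] [NormedSpace ℂ Y] (e : (Y × Y × Y) ≃L[ℂ] X)
    (f : StrongDual ℂ Y × StrongDual ℂ Y × StrongDual ℂ Y) (p : Y × Y × Y) :
    dualEquiv e f (e p) = f.1 p.1 + (f.2.1 p.2.1 + f.2.2 p.2.2) := by
  simp [dualEquiv]

/-- The dual of a module in triangular form is in cotriangular form. -/
def TriangularForm.dual {X : BanachModule (T₀ S)} {Y : SymmetricModule (L1 S)}
    (h : X.TriangularForm Y) : X.dual.CotriangularForm Y.dual where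
  equiv := dualEquiv h.equiv
  left_equiv x f := by
    refine ContinuousLinearMap.ext fun v => ?_
    obtain ⟨p, rfl⟩ := h.equiv.surjective v
    refine (congrArg _ (h.right_equiv x p)).trans ((dualEquiv_apply _ _ _).trans
      (Eq.trans ?_ (dualEquiv_apply _ _ _).symm))
    simp only [map_add]
    obtain ⟨f₁, f₂, f₃⟩ : StrongDual ℂ Y.carrier × StrongDual ℂ Y.carrier × StrongDual ℂ Y.carrier :=
      f
    change _ = f₁ (Y.act x.e₁₁ p.1) + f₂ (Y.act x.e₁₂ p.1) +
      (f₂ (Y.act x.e₂₂ p.2.1) + f₃ (Y.act x.e₂₂ p.2.2))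
    ring
  right_equiv x f := by
    refine ContinuousLinearMap.ext fun v => ?_
    obtain ⟨p, rfl⟩ := h.equiv.surjective v
    refine (congrArg _ (h.left_equiv x p)).trans ((dualEquiv_apply _ _ _).trans
      (Eq.trans ?_ (dualEquiv_apply _ _ _).symm))
    simp only [map_add]
    obtain ⟨f₁, f₂, f₃⟩ : StrongDual ℂ Y.carrier × StrongDual ℂ Y.carrier × StrongDual ℂ Y.carrier :=
      f
    change _ = f₁ (Y.act x.e₁₁ p.1) + (f₂ (Y.act x.e₁₁ p.2.1) +
      (f₂ (Y.act x.e₁₂ p.2.2) + f₃ (Y.act x.e₂₂ p.2.2)))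
    ring

/-- The dual of a module in cotriangular form is in triangular form. -/
def CotriangularForm.dual {X : BanachModule (T₀ S)} {Y : SymmetricModule (L1 S)}
    (h : X.CotriangularForm Y) : X.dual.TriangularForm Y.dual where
  equiv := dualEquiv h.equiv
  left_equiv x f := by
    refine ContinuousLinearMap.ext fun v => ?_
    obtain ⟨p, rfl⟩ := h.equiv.surjective v
    refine (congrArg _ (h.right_equiv x p)).trans ((dualEquiv_apply _ _ _).trans
      (Eq.trans ?_ (dualEquiv_apply _ _ _).symm))
    simp only [map_add]
    obtain ⟨f₁, f₂, f₃⟩ : StrongDual ℂ Y.carrier × StrongDual ℂ Y.carrier × StrongDual ℂ Y.carrier :=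
      f
    change _ = f₁ (Y.act x.e₁₁ p.1) + ((f₂ (Y.act x.e₁₁ p.2.1) +
      f₃ (Y.act x.e₁₂ p.2.1)) + f₃ (Y.act x.e₂₂ p.2.2))
    ring
  right_equiv x f := by
    refine ContinuousLinearMap.ext fun v => ?_
    obtain ⟨p, rfl⟩ := h.equiv.surjective v
    refine (congrArg _ (h.left_equiv x p)).trans ((dualEquiv_apply _ _ _).trans
      (Eq.trans ?_ (dualEquiv_apply _ _ _).symm))
    simp only [map_add]
    obtain ⟨f₁, f₂, f₃⟩ : StrongDual ℂ Y.carrier × StrongDual ℂ Y.carrier × StrongDual ℂ Y.carrier :=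
      f
    change _ = f₁ (Y.act x.e₁₁ p.1) + ((f₁ (Y.act x.e₁₂ p.2.1) +
      f₂ (Y.act x.e₂₂ p.2.1)) + f₃ (Y.act x.e₂₂ p.2.2))
    ring

/-- `ℓ¹(S)` as a module over itself. -/
def _root_.SymmetricModule.self (S : Type u) [CommSemigroup S] : SymmetricModule (L1 S) where
  carrier := L1 S
  act := ContinuousLinearMap.mul ℂ (L1 S)
  act_mul a b y := by simp [mul_assoc]
  act_comm a b y := by
    simp only [ContinuousLinearMap.mul_apply', ← mul_assoc, L1.mul_comm' a b]

/-- The generators of $J$ vanish by associativity, so the zero ideal already qualifies. -/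
theorem J_T₀ : (T₀ S).J = ⊥ := by
  refine le_antisymm (sInf_le ?_) bot_le
  exact
    { isClosed := isClosed_singleton
      mul_mem_left := by
        rintro a x hx
        rw [(Submodule.mem_bot ℂ).1 hx, mul_zero]; exact Submodule.zero_mem _
      mul_mem_right := by
        rintro a x hx
        rw [(Submodule.mem_bot ℂ).1 hx, zero_mul]; exact Submodule.zero_mem _
      gen_mem := fun α a b => by
        simp [T₀, mul_assoc] }

theorem nonempty_triangularForm_quotientModule :
    Nonempty ((T₀ S).quotientModule.TriangularForm (SymmetricModule.self S)) := by
  let A := L1 S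
  let e₁ : (A × A × A) ≃L[ℂ] Tri A :=
    ((ContinuousLinearEquiv.refl ℂ A).prodCongr
      (WithLp.prodContinuousLinearEquiv 1 ℂ A A).symm).trans
      (WithLp.prodContinuousLinearEquiv 1 ℂ A (WithLp 1 (A × A))).symm
  let e₂ : Tri A →L[ℂ] (T₀ S).quotientModule.carrier := (T₀ S).J.mkQL
  have he₂ : Function.Bijective e₂ := by
    refine ⟨?_, fun y => ?_⟩
    · rw [injective_iff_map_eq_zero]
      intro x hx
      have := (Submodule.Quotient.mk_eq_zero (T₀ S).J).1 hx
      rwa [J_T₀, Submodule.mem_bot] at this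
    · obtain ⟨x, rfl⟩ := Submodule.Quotient.mk_surjective (T₀ S).J y
      exact ⟨x, rfl⟩
  let e := e₁.trans (ContinuousLinearEquiv.ofBijective e₂ (LinearMap.ker_eq_bot.2 he₂.1)
    (LinearMap.range_eq_top.2 he₂.2))
  have he : ∀ p : A × A × A, e p = Submodule.Quotient.mk (Tri.mk p.1 p.2.1 p.2.2) := fun _ => rfl
  refine ⟨⟨e, fun x p => ?_, fun x p => ?_⟩⟩
  · refine Eq.trans ?_ (he _).symm
    refine congrArg Submodule.Quotient.mk (Tri.ext rfl rfl rfl : x * Tri.mk _ _ _ = _)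
  -- `TriangularForm` writes right multiplication with the same action as left multiplication; this
  -- is where commutativity of $\ell^1(S)$ enters.
  · refine Eq.trans ?_ (he _).symm
    refine congrArg Submodule.Quotient.mk (Tri.ext ?_ ?_ ?_ : Tri.mk _ _ _ * x = _)
    · exact L1.mul_comm' _ _
    · exact congrArg₂ (· + ·) (L1.mul_comm' _ _) (L1.mul_comm' _ _)
    · exact L1.mul_comm' _ _

/-- Dualizing exchanges left and right actions and hence the two forms. Only the alternative is
recorded, not the parity of $n$. -/
theorem exists_form_iteratedDual (n : ℕ) : ∃ Y : SymmetricModule (L1 S),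
    Nonempty (((T₀ S).quotientModule.iteratedDual n).TriangularForm Y) ∨
    Nonempty (((T₀ S).quotientModule.iteratedDual n).CotriangularForm Y) := by
  induction n with
  | zero => exact ⟨_, Or.inl nonempty_triangularForm_quotientModule⟩
  | succ n ih =>
    obtain ⟨Y, ⟨h⟩ | ⟨h⟩⟩ := ih
    · exact ⟨Y.dual, Or.inr (h.map TriangularForm.dual)⟩
    · exact ⟨Y.dual, Or.inl (h.map CotriangularForm.dual)⟩

/-- The matrices $\alpha I$ are central in $\mathcal T_0$, and equality of the two actions passes to
transposes. -/
theorem isCommutative_iteratedDual (n : ℕ) :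
    ((T₀ S).quotientModule.iteratedDual n).IsCommutative := by
  induction n with
  | zero =>
    rintro ⟨_, α, hα, rfl⟩ v
    obtain ⟨x, rfl⟩ := Submodule.Quotient.mk_surjective (T₀ S).J v
    refine congrArg Submodule.Quotient.mk (?_ : Tri.mk α 0 α * x = x * Tri.mk α 0 α)
    ext1 <;> simp [L1.mul_comm']
  | succ n ih =>
    exact fun α f => ContinuousLinearMap.ext fun v => congrArg _ (ih α v).symm

end BanachModule

/-! ### Derivations -/

namespace Tri

variable {A : Type u} [NonUnitalNormedRing A]

@[simp] theorem mk_mul_mk (a m b a' m' b' : A) :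
    mk a m b * mk a' m' b' = mk (a * a') (a * m' + m * b') (b * b') := rfl

@[simp] theorem mk_zero : mk (0 : A) 0 0 = 0 := rfl

variable [NormedSpace ℂ A]

/-- The embedding of `A` as the upper left entries. -/
def ι₁₁ : A →L[ℂ] Tri A :=
  LinearMap.mkContinuous
    { toFun := fun a => mk a 0 0
      map_add' := fun a b => by ext <;> simp
      map_smul' := fun c a => by ext <;> simp } 1 fun a => by simp [norm_eq]

/-- The embedding of `A` as the upper right entries. -/
def ι₁₂ : A →L[ℂ] Tri A :=
  LinearMap.mkContinuous
    { toFun := fun a => mk 0 a 0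
      map_add' := fun a b => by ext <;> simp
      map_smul' := fun c a => by ext <;> simp } 1 fun a => by simp [norm_eq]

/-- The embedding of `A` as the lower right entries. -/
def ι₂₂ : A →L[ℂ] Tri A :=
  LinearMap.mkContinuous
    { toFun := fun a => mk 0 0 a
      map_add' := fun a b => by ext <;> simp
      map_smul' := fun c a => by ext <;> simp } 1 fun a => by simp [norm_eq]

@[simp] theorem ι₁₁_apply (a : A) : ι₁₁ a = mk a 0 0 := rfl
@[simp] theorem ι₁₂_apply (a : A) : ι₁₂ a = mk 0 a 0 := rfl
@[simp] theorem ι₂₂_apply (a : A) : ι₂₂ a = mk 0 0 a := rfl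

theorem eq_sum (x : Tri A) : x = ι₁₁ x.e₁₁ + ι₁₂ x.e₁₂ + ι₂₂ x.e₂₂ := by
  ext <;> simp

end Tri

/-! ### Automatic linearity of module derivations -/

namespace BanachModule

variable {S : Type u} [CommSemigroup S]

/-- Module derivations on `𝒯₀` are `ℂ`-linear on each entry. -/
theorem IsModuleDerivation.map_smul_entry (hS : IsInverseSemigroup S) {X : BanachModule (T₀ S)}
    {D : Tri (L1 S) → X.carrier} (hD : X.IsModuleDerivation D) (ι : L1 S →L[ℂ] Tri (L1 S))
    (hι : ∀ a b, Tri.mk a 0 a * ι b = ι (a * b)) (c : ℂ) (f : L1 S) :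
    D (ι (c • f)) = c • D (ι f) := by
  obtain ⟨M, -, hM⟩ := hD.bounded
  let D' : Tri (L1 S) →+ X.carrier := AddMonoidHom.mk' D hD.map_add
  have hc : Continuous (fun f => D' (ι f)) :=
    (AddMonoidHomClass.continuous_of_bound D' M hM).comp ι.continuous
  -- The complex scalar is absorbed into $\mathfrak T_0$: $z\delta_s=(z\delta_e)\delta_s$, and `D`
  -- commutes with the action of $z\delta_e I$.
  have hs : ∀ (z : ℂ) (s : S), D (ι (z • L1.delta s)) = z • D (ι (L1.delta s)) := by
    intro z s
    obtain ⟨e, he, -, hs, -⟩ := hS.exists_idempotent s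
    have hmem : L1.delta e ∈ l1E S := fun t ht =>
      L1.delta_apply_ne fun h => ht (h ▸ he)
    let α : Tri.diagonal (l1E S) := ⟨Tri.mk (L1.delta e) 0 (L1.delta e), _, hmem, rfl⟩
    have hα : (T₀ S).left α (ι (L1.delta s)) = ι (L1.delta s) :=
      (hι _ _).trans (by rw [L1.delta_mul_delta, hs])
    have h1 := hD.map_left (z • α) (ι (L1.delta s))
    rw [map_smul, map_smul, smul_apply, smul_apply,
      ← hD.map_left, hα, ← map_smul] at h1
    exact h1
  -- Additivity and the norm bound make `D` continuous, so it commutes with the expansion in point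
  -- masses.
  have hsum : ∀ f : L1 S, HasSum (fun s => f s • D (ι (L1.delta s))) (D (ι f)) := by
    intro f
    have h1 := (L1.hasSum_delta f).map (D'.comp (ι : L1 S →+ Tri (L1 S))) hc
    exact (funext fun s => hs (f s) s) ▸ h1
  refine (hsum (c • f)).unique ?_
  simpa [smul_smul] using (hsum f).const_smul c

/-- Module derivations on `𝒯₀` are bounded linear maps. -/
theorem IsModuleDerivation.exists_clm_eq (hS : IsInverseSemigroup S) {X : BanachModule (T₀ S)}
    {D : Tri (L1 S) → X.carrier} (hD : X.IsModuleDerivation D) :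
    ∃ T : Tri (L1 S) →L[ℂ] X.carrier, ∀ x, T x = D x := by
  obtain ⟨M, -, hM⟩ := hD.bounded
  refine ⟨LinearMap.mkContinuous
    { toFun := D, map_add' := hD.map_add, map_smul' := fun c x => ?_ } M hM, fun x => rfl⟩
  rw [RingHom.id_apply]
  conv_lhs => rw [Tri.eq_sum (c • x)]
  conv_rhs => rw [Tri.eq_sum x]
  rw [hD.map_add, hD.map_add, hD.map_add, hD.map_add, smul_add, smul_add]
  congr 2
  · exact hD.map_smul_entry hS Tri.ι₁₁ (fun a b => by simp) _ _
  · exact hD.map_smul_entry hS Tri.ι₁₂ (fun a b => by simp) _ _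
  · exact hD.map_smul_entry hS Tri.ι₂₂ (fun a b => by simp) _ _

end BanachModule

/-! ### Derivations entry by entry -/

namespace SymmetricModule

variable {S : Type u} [CommSemigroup S]

/-- Two elements whose actions on products cancel have opposite actions. -/
theorem act_eq_neg (hS : IsInverseSemigroup S) (Y : SymmetricModule (L1 S)) {g g' : Y.carrier}
    (h : ∀ a b, Y.act b (Y.act a g) + Y.act a (Y.act b g') = 0) (a : L1 S) :
    Y.act a g = -Y.act a g' := by
  have h0 : Y.act.flip (g + g') = 0 := eq_zero_of_map_mul hS _ fun a b => by
    rw [ContinuousLinearMap.flip_apply, Y.act_mul, map_add, map_add, Y.act_comm a b g]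
    exact h a b
  have h1 : Y.act a (g + g') = 0 := congrArg (fun T => T a) h0
  rw [map_add] at h1
  exact eq_neg_of_add_eq_zero_left h1

/-- Derivations of triangular matrices into triangular matrices over a dual module. -/
theorem exists_eq_of_triangular_derivation (hS : IsInverseSemigroup S) {k : ℕ}
    (hD : SatisfiesD S k) (Y : SymmetricModule (L1 S))
    (C₁ C₂ C₃ : Tri (L1 S) →L[ℂ] Y.dual.carrier)
    (h₁ : ∀ x y, C₁ (x * y) = Y.dual.act y.e₁₁ (C₁ x) + Y.dual.act x.e₁₁ (C₁ y))
    (h₂ : ∀ x y, C₂ (x * y) = (Y.dual.act y.e₁₂ (C₁ x) + Y.dual.act y.e₂₂ (C₂ x)) +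
      (Y.dual.act x.e₁₁ (C₂ y) + Y.dual.act x.e₁₂ (C₃ y)))
    (h₃ : ∀ x y, C₃ (x * y) = Y.dual.act y.e₂₂ (C₃ x) + Y.dual.act x.e₂₂ (C₃ y)) :
    ∃ g g' : Y.dual.carrier, ∀ x, C₁ x = 0 ∧
      C₂ x = Y.dual.act x.e₁₁ g + Y.dual.act x.e₁₂ g' - Y.dual.act x.e₂₂ g ∧ C₃ x = 0 := by
  have a₁ : C₁ ∘L Tri.ι₁₁ = 0 := derivation_eq_zero hS Y.dual _ fun a b => by
    simpa using h₁ (Tri.ι₁₁ a) (Tri.ι₁₁ b)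
  have b₁ : C₁ ∘L Tri.ι₂₂ = 0 := eq_zero_of_map_mul hS _ fun a b => by
    simpa using h₁ (Tri.ι₂₂ a) (Tri.ι₂₂ b)
  have m₁ : C₁ ∘L Tri.ι₁₂ = 0 := eq_zero_of_map_mul hS _ fun a b => by
    simpa using h₁ (Tri.ι₁₂ a) (Tri.ι₂₂ b)
  have a₃ : C₃ ∘L Tri.ι₁₁ = 0 := eq_zero_of_map_mul hS _ fun a b => by
    simpa using h₃ (Tri.ι₁₁ a) (Tri.ι₁₁ b)
  have b₃ : C₃ ∘L Tri.ι₂₂ = 0 := derivation_eq_zero hS Y.dual _ fun a b => by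
    simpa using h₃ (Tri.ι₂₂ a) (Tri.ι₂₂ b)
  have m₃ : C₃ ∘L Tri.ι₁₂ = 0 := eq_zero_of_map_mul hS _ fun a b => by
    simpa using h₃ (Tri.ι₁₁ a) (Tri.ι₁₂ b)
  obtain ⟨g, hg⟩ := exists_eq_act hS hD Y (C₂ ∘L Tri.ι₁₁) fun a b => by
    simpa using h₂ (Tri.ι₁₁ a) (Tri.ι₁₁ b)
  obtain ⟨r, hr⟩ := exists_eq_act hS hD Y (C₂ ∘L Tri.ι₂₂) fun a b => by
    rw [L1.mul_comm']
    simpa using h₂ (Tri.ι₂₂ b) (Tri.ι₂₂ a)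
  have hb : ∀ a, C₁ (Tri.mk a 0 0) = 0 := fun a => congrArg (fun T => T a) a₁
  obtain ⟨g', hg'⟩ := exists_eq_act hS hD Y (C₂ ∘L Tri.ι₁₂) fun a b => by
    simpa [hb] using h₂ (Tri.ι₁₁ a) (Tri.ι₁₂ b)
  -- An upper left entry times a lower right entry is zero. The Leibniz rule for this product makes
  -- the coefficients on the two diagonal entries opposite.
  have hgr := act_eq_neg hS Y.dual (g := r) (g' := g) fun a b => by
    rw [← hg, ← hr]
    simpa [add_comm] using (h₂ (Tri.ι₁₁ b) (Tri.ι₂₂ a)).symm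
  refine ⟨g, g', fun x => ?_⟩
  have hx : ∀ C : Tri (L1 S) →L[ℂ] Y.dual.carrier, C x = (C ∘L Tri.ι₁₁) x.e₁₁ +
      (C ∘L Tri.ι₁₂) x.e₁₂ + (C ∘L Tri.ι₂₂) x.e₂₂ := fun C => by
    conv_lhs => rw [Tri.eq_sum x, map_add, map_add]
    rfl
  refine ⟨?_, ?_, ?_⟩
  · rw [hx, a₁, b₁, m₁]; simp
  · rw [hx, hg, hr, hg', hgr, ← sub_eq_add_neg]
  · rw [hx, a₃, b₃, m₃]; simp

/-- Derivations of triangular matrices into the transposed module over a dual module. -/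
theorem exists_eq_of_cotriangular_derivation (hS : IsInverseSemigroup S) {k : ℕ}
    (hD : SatisfiesD S k) (Y : SymmetricModule (L1 S))
    (C₁ C₂ C₃ : Tri (L1 S) →L[ℂ] Y.dual.carrier)
    (h₁ : ∀ x y, C₁ (x * y) = Y.dual.act y.e₁₁ (C₁ x) +
      (Y.dual.act x.e₁₁ (C₁ y) + Y.dual.act x.e₁₂ (C₂ y)))
    (h₂ : ∀ x y, C₂ (x * y) = Y.dual.act y.e₁₁ (C₂ x) + Y.dual.act x.e₂₂ (C₂ y))
    (h₃ : ∀ x y, C₃ (x * y) = (Y.dual.act y.e₁₂ (C₂ x) + Y.dual.act y.e₂₂ (C₃ x)) +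
      Y.dual.act x.e₂₂ (C₃ y)) :
    ∃ g : Y.dual.carrier, ∀ x, C₁ x = Y.dual.act x.e₁₂ g ∧
      C₂ x = Y.dual.act x.e₂₂ g - Y.dual.act x.e₁₁ g ∧ C₃ x = -Y.dual.act x.e₁₂ g := by
  have a₁ : C₁ ∘L Tri.ι₁₁ = 0 := derivation_eq_zero hS Y.dual _ fun a b => by
    simpa using h₁ (Tri.ι₁₁ a) (Tri.ι₁₁ b)
  have b₁ : C₁ ∘L Tri.ι₂₂ = 0 := eq_zero_of_map_mul hS _ fun a b => by
    simpa using h₁ (Tri.ι₂₂ a) (Tri.ι₂₂ b)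
  have a₃ : C₃ ∘L Tri.ι₁₁ = 0 := eq_zero_of_map_mul hS _ fun a b => by
    simpa using h₃ (Tri.ι₁₁ a) (Tri.ι₁₁ b)
  have b₃ : C₃ ∘L Tri.ι₂₂ = 0 := derivation_eq_zero hS Y.dual _ fun a b => by
    simpa using h₃ (Tri.ι₂₂ a) (Tri.ι₂₂ b)
  have m₂ : C₂ ∘L Tri.ι₁₂ = 0 := eq_zero_of_map_mul hS _ fun a b => by
    simpa using h₂ (Tri.ι₁₁ a) (Tri.ι₁₂ b)
  obtain ⟨r, hr⟩ := exists_eq_act hS hD Y (C₂ ∘L Tri.ι₁₁) fun a b => by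
    rw [L1.mul_comm']
    simpa using h₂ (Tri.ι₁₁ b) (Tri.ι₁₁ a)
  obtain ⟨g, hg⟩ := exists_eq_act hS hD Y (C₂ ∘L Tri.ι₂₂) fun a b => by
    simpa using h₂ (Tri.ι₂₂ a) (Tri.ι₂₂ b)
  have hgr := act_eq_neg hS Y.dual (g := r) (g' := g) fun a b => by
    rw [← hg, ← hr]
    simpa [add_comm] using (h₂ (Tri.ι₂₂ b) (Tri.ι₁₁ a)).symm
  -- Here the upper right entry needs no new limit: the Leibniz rule for
  -- $\iota_{12}(a)\,\iota_{22}(b)$, and for $\iota_{11}(a)\,\iota_{12}(b)$ below, expresses it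
  -- through the middle component.
  have m₁ : C₁ ∘L Tri.ι₁₂ - Y.dual.act.flip g = 0 := eq_zero_of_map_mul hS _ fun a b => by
    rw [sub_apply, ContinuousLinearMap.flip_apply, Y.dual.act_mul, ← hg,
      sub_eq_zero]
    simpa using h₁ (Tri.ι₁₂ a) (Tri.ι₂₂ b)
  have m₃ : C₃ ∘L Tri.ι₁₂ + Y.dual.act.flip g = 0 := eq_zero_of_map_mul hS _ fun a b => by
    rw [add_apply, ContinuousLinearMap.flip_apply, Y.dual.act_mul,
      Y.dual.act_comm, ← neg_eq_iff_eq_neg.2 (hgr a), ← hr, map_neg, ← sub_eq_add_neg, sub_eq_zero]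
    simpa using h₃ (Tri.ι₁₁ a) (Tri.ι₁₂ b)
  refine ⟨g, fun x => ?_⟩
  have hx : ∀ C : Tri (L1 S) →L[ℂ] Y.dual.carrier, C x = (C ∘L Tri.ι₁₁) x.e₁₁ +
      (C ∘L Tri.ι₁₂) x.e₁₂ + (C ∘L Tri.ι₂₂) x.e₂₂ := fun C => by
    conv_lhs => rw [Tri.eq_sum x, map_add, map_add]
    rfl
  refine ⟨?_, ?_, ?_⟩
  · rw [hx, a₁, b₁, sub_eq_zero.1 m₁]; simp
  · rw [hx, hg, hr, m₂, hgr]; simp; abel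
  · rw [hx, a₃, b₃, eq_neg_of_add_eq_zero_left m₃]; simp

end SymmetricModule

/-! ### Innerness in both forms -/

namespace BanachModule

variable {S : Type u} [CommSemigroup S]

theorem TriangularForm.isInner (hS : IsInverseSemigroup S) {k : ℕ} (hk : SatisfiesD S k)
    {X : BanachModule (T₀ S)} {Y : SymmetricModule (L1 S)} (h : X.TriangularForm Y.dual)
    {D : Tri (L1 S) → X.carrier} (hD : X.IsModuleDerivation D) : X.IsInner D := by
  obtain ⟨T, hT⟩ := hD.exists_clm_eq hS
  let C := h.equiv.symm.toContinuousLinearMap ∘L T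
  have hC : ∀ x, D x = h.equiv (C x) := fun x => by simp [C, hT]
  -- The placeholders are the two Leibniz terms transported through `h.equiv`; unification supplies
  -- them.
  have hmul : ∀ x y, C (x * y) = _ + _ := fun x y => h.equiv.injective <| by
    rw [← hC, hD.leibniz, hC, hC, h.left_equiv, h.right_equiv, ← map_add]
  obtain ⟨g, g', hg⟩ := SymmetricModule.exists_eq_of_triangular_derivation hS hk Y
    (.fst ℂ _ _ ∘L C) (.fst ℂ _ _ ∘L .snd ℂ _ _ ∘L C) (.snd ℂ _ _ ∘L .snd ℂ _ _ ∘L C)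
    (fun x y => congrArg (fun p => p.1) (hmul x y))
    (fun x y => congrArg (fun p => p.2.1) (hmul x y))
    (fun x y => congrArg (fun p => p.2.2) (hmul x y))
  -- The element $(p,q,r)$ gives the middle entry $x_{11}q+x_{12}(r-p)-x_{22}q$ and zero elsewhere.
  -- Only $r-p=g'$ matters, so $p=0$ is a free choice.
  refine ⟨h.equiv (0, g, g'), fun x => ?_⟩
  rw [hC, h.left_equiv, h.right_equiv, ← map_sub]
  obtain ⟨e₁, e₂, e₃⟩ := hg x
  refine congrArg _ (Prod.ext ?_ (Prod.ext ?_ ?_))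
  · exact e₁.trans (by simp)
  · exact e₂.trans (by simp)
  · exact e₃.trans (by simp)

theorem CotriangularForm.isInner (hS : IsInverseSemigroup S) {k : ℕ} (hk : SatisfiesD S k)
    {X : BanachModule (T₀ S)} {Y : SymmetricModule (L1 S)} (h : X.CotriangularForm Y.dual)
    {D : Tri (L1 S) → X.carrier} (hD : X.IsModuleDerivation D) : X.IsInner D := by
  obtain ⟨T, hT⟩ := hD.exists_clm_eq hS
  let C := h.equiv.symm.toContinuousLinearMap ∘L T
  have hC : ∀ x, D x = h.equiv (C x) := fun x => by simp [C, hT]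
  have hmul : ∀ x y, C (x * y) = _ + _ := fun x y => h.equiv.injective <| by
    rw [← hC, hD.leibniz, hC, hC, h.left_equiv, h.right_equiv, ← map_add]
  obtain ⟨g, hg⟩ := SymmetricModule.exists_eq_of_cotriangular_derivation hS hk Y
    (.fst ℂ _ _ ∘L C) (.fst ℂ _ _ ∘L .snd ℂ _ _ ∘L C) (.snd ℂ _ _ ∘L .snd ℂ _ _ ∘L C)
    (fun x y => congrArg (fun p => p.1) (hmul x y))
    (fun x y => congrArg (fun p => p.2.1) (hmul x y))
    (fun x y => congrArg (fun p => p.2.2) (hmul x y))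
  -- The outer coordinates contribute nothing to the commutator in this form.
  refine ⟨h.equiv (0, g, 0), fun x => ?_⟩
  rw [hC, h.left_equiv, h.right_equiv, ← map_sub]
  obtain ⟨e₁, e₂, e₃⟩ := hg x
  refine congrArg _ (Prod.ext ?_ (Prod.ext ?_ ?_))
  · exact e₁.trans (by simp)
  · exact e₂.trans (by simp)
  · exact e₃.trans (by simp)

end BanachModule

end

theorem mainTheorem1 {S : Type*} [CommSemigroup S] (hS : IsInverseSemigroup S)
    (hD : ∃ k : ℕ, 1 ≤ k ∧ SatisfiesD S k) :
    (T₀ S).IsPermanentlyWeaklyModuleAmenable := by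
  obtain ⟨k, -, hk⟩ := hD
  intro n hn
  -- Since $n\ge1$, the coefficient module is itself a dual, as the weak* argument requires.
  obtain ⟨n, rfl⟩ := Nat.exists_eq_succ_of_ne_zero (Nat.one_le_iff_ne_zero.1 hn)
  refine ⟨BanachModule.isCommutative_iteratedDual _, fun D hD => ?_⟩
  obtain ⟨Y, h | h⟩ := BanachModule.exists_form_iteratedDual (S := S) n
  · exact h.some.dual.isInner hS hk hD
  · exact h.some.dual.isInner hS hk hD
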